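/- Let $\mathbf k$ be an algebraically closed field and let $\mathcal C$ be a pivotal finite tensor category over $\mathbf k$, that is, a rigid monoidal category that is a finite $\mathbf k$-linear abelian category (equivalent to the category of finite-dimensional modules over a finite-dimensional algebra), with $\mathbf k$-bilinear tensor product, simple unit object $\mathbb 1$, and an isomorphism $\mathfrak p_X\colon X\to X^{**}$ of tensor functors. Here $X^*$ is the dual with evaluation $\mathrm{ev}_X\colon X^*\otimes X\to\mathbb 1$ and coevaluation $\mathrm{coev}_X\colon\mathbb 1\to X\otimes X^*$. Let $\mathcal M$ be an exact left $\mathcal C$-module category: a finite $\mathbf k$-linear abelian category with an action $\triangleright$ of $\mathcal C$ that is $\mathbf k$-bilinear and right exact in each variable, such that $P\triangleright M$ is projective whenever $P\in\mathcal C$ is projective. Let $[-,-]\colon\mathcal M^{\mathrm{op}}\times\mathcal M\to\mathcal C$ be an internal Hom functor, so $\mathrm{Hom}_{\mathcal M}(X\triangleright M,N)\cong\mathrm{Hom}_{\mathcal C}(X,[M,N])$ naturally in $X$, $M$, $N$. Let $(\mathbb S,\phi)$ be a relative Serre functor of $\mathcal M$: a functor $\mathbb S\colon\mathcal M\to\mathcal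 M$ together with an isomorphism $\phi_{M,N}\colon[M,N]^*\to[N,\mathbb S(M)]$, natural in $M$ and $N$, that is compatible with the $\mathcal C$-module structures in the variable $N$, i.e. for all $X\in\mathcal C$ the morphism $\phi_{M,X\triangleright N}$ equals the composite $$[M,X\triangleright N]^*\to(X\otimes[M,N])^*\cong[M,N]^*\otimes X^*\xrightarrow{\phi_{M,N}\otimes\mathrm{id}}[N,\mathbb S(M)]\otimes X^*\to[X\triangleright N,\mathbb S(M)],$$ where the first and last morphisms come from the canonical module structures $X\otimes[M,N]\to[M,X\triangleright N]$ and $[N,N']\otimes X^*\to[X\triangleright N,N']$ of $[-,-]$. (Equivalently, $\phi$ is an isomorphism of $\mathcal C$-bimodule functors for a, necessarily unique, twisted module structure $X^{**}\triangleright\mathbb S(M)\cong\mathbb S(X\triangleright M)$ on $\mathbb S$.) For $M\in\mathcal M$ let the trace be the composite $$\mathrm{tr}_M\colon[M,\mathbb S(M)]\xrightarrow{\phi_{M,M}^{-1}}[M,M]^*\to\mathbb 1^*\cong\mathbb 1,$$ where the second morphism is the dual of the unit $\mathbb 1\to[M,M]$. Then, for every object $M\in\mathcal M$ and every isomorphism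 $p\colon M\to\mathbb S(M)$ in $\mathcal M$, the algebra $A:=[M,M]$ (with multiplication $\mu$ the composition of the internal Hom) is a Frobenius algebra in $\mathcal C$ with Frobenius form $\lambda:=\mathrm{tr}_M\circ[M,p]\colon A\to\mathbb 1$; that is, the morphism $$\psi:=\Big(A\xrightarrow{\mathrm{id}_A\otimes\mathrm{coev}_A}A\otimes A\otimes A^*\xrightarrow{\lambda\mu\otimes\mathrm{id}}A^*\Big)$$ is an isomorphism. Moreover, the Nakayama automorphism $\nu_A:=\mathfrak p_A^{-1}\circ(\psi^{-1})^*\circ\psi$ of $(A,\lambda)$ is $$\nu_A=\mathfrak p_A^{-1}\circ\phi_{M,M}^*\circ\phi_{M,\mathbb S(M)}^{-1}\circ[p^{-1},p].$$ -/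

import Mathlib

open CategoryTheory CategoryTheory.MonoidalCategory CategoryTheory.Limits Opposite
open scoped CategoryTheory.MonoidalCategory.MonoidalLeftAction

universe w v₁ u₁ v₂ u₂

namespace RelSerre

/-! ### Finite abelian categories, finite tensor categories, exact module categories -/

section Finite

/-- A `k`-linear abelian category is *finite* if it is equivalent, as a `k`-linear category, to the
category of finite-dimensional left modules over some finite-dimensional `k`-algebra. -/
class IsFiniteAbelian (k : Type w) [Field k] (C : Type u₁) [Category.{v₁} C] [Abelian C]
    [Linear k C] : Prop where
  exists_equivalence : ∃ (A : Type w) (_ : Ring A) (_ : Algebra k A) (_ : Module.Finite k A)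
    (e : C ≌ FGModuleCat.{w} A) (_ : e.functor.Additive), e.functor.Linear k

/-- A finite tensor category over `k`: a rigid monoidal category which is a finite abelian category
over `k`, with `k`-bilinear tensor product and simple unit object. -/
class IsFiniteTensorCategory (k : Type w) [Field k] (C : Type u₁) [Category.{v₁} C] [Abelian C]
    [Linear k C] [MonoidalCategory C] [RigidCategory C] : Prop
    extends IsFiniteAbelian k C, MonoidalPreadditive C, MonoidalLinear k C where
  simple_unit : Simple (𝟙_ C)

variable (k : Type w) [Field k] (C : Type u₁) [Category.{v₁} C] [Abelian C]
  [Linear k C] [MonoidalCategory C] (M : Type u₂) [Category.{v₂} M] [Abelian M] [Linear k M]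
  [MonoidalLeftAction C M]

/-- A finite left `C`-module category: a left `C`-module category which is a finite abelian
category over `k`, with action `k`-bilinear and right exact in each variable. -/
class IsFiniteModuleCategory : Prop extends IsFiniteAbelian k M where
  action_add (X : C) {N N' : M} (f g : N ⟶ N') : X ⊴ₗ (f + g) = X ⊴ₗ f + X ⊴ₗ g
  add_action {X X' : C} (f g : X ⟶ X') (N : M) : (f + g) ⊵ₗ N = f ⊵ₗ N + g ⊵ₗ N
  action_smul (X : C) {N N' : M} (r : k) (f : N ⟶ N') : X ⊴ₗ (r • f) = r • (X ⊴ₗ f)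
  smul_action {X X' : C} (r : k) (f : X ⟶ X') (N : M) : (r • f) ⊵ₗ N = r • (f ⊵ₗ N)
  rightExact_left (X : C) : PreservesFiniteColimits (MonoidalLeftAction.actionLeft M X)
  rightExact_right (N : M) : PreservesFiniteColimits (MonoidalLeftAction.actionRight C N)

/-- An exact left `C`-module category: a finite left `C`-module category such that `P ⊙ₗ N` is
projective for every projective `P : C` and every `N : M`. -/
class IsExactModuleCategory : Prop extends IsFiniteModuleCategory k C M where
  projective_action (P : C) (N : M) : Projective P → Projective (P ⊙ₗ N)

end Finite

/-! ### Duality and pivotal structures -/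

section Dual

variable {C : Type u₁} [Category.{v₁} C] [MonoidalCategory C] [RigidCategory C]

/-- The dual object `X*`, with evaluation `X* ⊗ X ⟶ 𝟙` and coevaluation `𝟙 ⟶ X ⊗ X*` (a *left*
dual in the terminology of Etingof, Gelaki, Nikshych and Ostrik; a *right* dual in Mathlib's). -/
abbrev dual (X : C) : C := Xᘁ

/-- The evaluation `X* ⊗ X ⟶ 𝟙`. -/
abbrev ev (X : C) : dual X ⊗ X ⟶ 𝟙_ C := ε_ X (Xᘁ)

/-- The coevaluation `𝟙 ⟶ X ⊗ X*`. -/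
abbrev coev (X : C) : 𝟙_ C ⟶ X ⊗ dual X := η_ X (Xᘁ)

/-- The dual `f* : Y* ⟶ X*` of a morphism `f : X ⟶ Y`. -/
abbrev dualMap {X Y : C} (f : X ⟶ Y) : dual Y ⟶ dual X := fᘁ

/-- The canonical isomorphism `(X ⊗ Y)* ≅ Y* ⊗ X*`, by uniqueness of duals. -/
noncomputable def dualTensorIso (X Y : C) : dual (X ⊗ Y) ≅ dual Y ⊗ dual X :=
  rightDualIso (X := X ⊗ Y) inferInstance ExactPairing.tensor

variable (C) in
/-- The canonical isomorphism `𝟙* ≅ 𝟙`, by uniqueness of duals. -/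
noncomputable def dualUnitIso : dual (𝟙_ C) ≅ 𝟙_ C :=
  rightDualIso (X := 𝟙_ C) (RightRigidCategory.rightDual (𝟙_ C)).exact exactPairingUnit

/-- The isomorphism `Y* ≅ X*` that is dual to an isomorphism `X ≅ Y`. -/
def dualIso {X Y : C} (e : X ≅ Y) : dual Y ≅ dual X where
  hom := dualMap e.hom
  inv := dualMap e.inv
  hom_inv_id := by rw [← comp_rightAdjointMate, Iso.inv_hom_id, rightAdjointMate_id]
  inv_hom_id := by rw [← comp_rightAdjointMate, Iso.hom_inv_id, rightAdjointMate_id]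

/-- The canonical isomorphism `(X ⊗ Y)** ≅ (Y* ⊗ X*)* ≅ X** ⊗ Y**`. -/
noncomputable def doubleDualTensorIso (X Y : C) :
    dual (dual (X ⊗ Y)) ≅ dual (dual X) ⊗ dual (dual Y) :=
  dualIso (dualTensorIso X Y).symm ≪≫ dualTensorIso (dual Y) (dual X)

variable (C) in
/-- The canonical isomorphism `𝟙** ≅ 𝟙* ≅ 𝟙`. -/
noncomputable def doubleDualUnitIso : dual (dual (𝟙_ C)) ≅ 𝟙_ C :=
  dualIso (dualUnitIso C).symm ≪≫ dualUnitIso C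

variable (C) in
/-- A pivotal structure on `C`: an isomorphism `X ≅ X**` of tensor functors. -/
structure PivotalStructure where
  iso (X : C) : X ≅ dual (dual X)
  naturality {X Y : C} (f : X ⟶ Y) : f ≫ (iso Y).hom = (iso X).hom ≫ dualMap (dualMap f)
  unit : (iso (𝟙_ C)).hom ≫ (doubleDualUnitIso C).hom = 𝟙 (𝟙_ C)
  tensor (X Y : C) : (iso (X ⊗ Y)).hom ≫ (doubleDualTensorIso X Y).hom =
    (iso X).hom ⊗ₘ (iso Y).hom

/-! ### Frobenius algebras -/

/-- The morphism `ψ : A ⟶ A*` given by `A ⟶ A ⊗ A ⊗ A* ⟶ A*` (coevaluation, then `λ ∘ μ`). -/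
def frobeniusMap (A : C) [MonObj A] (lam : A ⟶ 𝟙_ C) : A ⟶ dual A :=
  (ρ_ A).inv ≫ A ◁ coev A ≫ (α_ A A (dual A)).inv ≫ (MonObj.mul ≫ lam) ▷ dual A ≫ (λ_ (dual A)).hom

/-- The pair `(A, λ)` is a Frobenius algebra with Frobenius form `λ`. -/
class IsFrobeniusAlgebra (A : C) [MonObj A] (lam : A ⟶ 𝟙_ C) : Prop where
  isIso_frobeniusMap : IsIso (frobeniusMap A lam)

attribute [instance] IsFrobeniusAlgebra.isIso_frobeniusMap

/-- The Nakayama automorphism `𝔭_A⁻¹ ∘ (ψ⁻¹)* ∘ ψ` of a Frobenius algebra. -/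
noncomputable def nakayama (piv : PivotalStructure C) (A : C) [MonObj A] (lam : A ⟶ 𝟙_ C)
    [IsFrobeniusAlgebra A lam] : A ⟶ A :=
  frobeniusMap A lam ≫ dualMap (inv (frobeniusMap A lam)) ≫ (piv.iso A).inv

end Dual

/-! ### Internal Hom -/

section InternalHom

variable (C : Type u₁) [Category.{v₁} C] [MonoidalCategory C]
  (M : Type u₂) [Category.{v₂} M] [MonoidalLeftAction C M]

/-- An internal Hom functor of `M`: a bifunctor `Mᵒᵖ ⥤ M ⥤ C` with bijections
`Hom_M(X ⊙ₗ N, N') ≃ Hom_C(X, [N, N'])` natural in all of `X`, `N`, `N'`. -/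
structure InternalHom where
  functor : Mᵒᵖ ⥤ M ⥤ C
  adj : (MonoidalLeftAction.curriedAction C M).flip ⊣₂ functor

variable {C M}

namespace InternalHom

variable (H : InternalHom C M)

/-- The object `[N, N']` of `C`. -/
abbrev hom (N N' : M) : C := (H.functor.obj (op N)).obj N'

/-- The morphism `[f, g] : [N₂, N'] ⟶ [N₁, N'']` for `f : N₁ ⟶ N₂` and `g : N' ⟶ N''`. -/
def map {N₁ N₂ N' N'' : M} (f : N₁ ⟶ N₂) (g : N' ⟶ N'') : H.hom N₂ N' ⟶ H.hom N₁ N'' :=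
  (H.functor.map f.op).app N' ≫ (H.functor.obj (op N₁)).map g

/-- The adjunction bijection `Hom_M(X ⊙ₗ N, N') ≃ Hom_C(X, [N, N'])`. -/
def homEquiv {X : C} {N N' : M} : (X ⊙ₗ N ⟶ N') ≃ (X ⟶ H.hom N N') :=
  H.adj.homEquiv (X₁ := N) (X₂ := X) (X₃ := N')

/-- The evaluation `[N, N'] ⊙ₗ N ⟶ N'` (counit of the adjunction). -/
def ieval (N N' : M) : H.hom N N' ⊙ₗ N ⟶ N' := H.homEquiv.symm (𝟙 (H.hom N N'))

/-- The coevaluation `X ⟶ [N, X ⊙ₗ N]` (unit of the adjunction). -/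
def icoev (X : C) (N : M) : X ⟶ H.hom N (X ⊙ₗ N) := H.homEquiv (𝟙 (X ⊙ₗ N))

/-- The composition `[N₂, N₃] ⊗ [N₁, N₂] ⟶ [N₁, N₃]`. -/
def icomp (N₁ N₂ N₃ : M) : H.hom N₂ N₃ ⊗ H.hom N₁ N₂ ⟶ H.hom N₁ N₃ :=
  H.homEquiv ((αₗ (H.hom N₂ N₃) (H.hom N₁ N₂) N₁).hom ≫
    H.hom N₂ N₃ ⊴ₗ H.ieval N₁ N₂ ≫ H.ieval N₂ N₃)

/-- The identity `𝟙 ⟶ [N, 𝟙 ⊙ₗ N] ≅ [N, N]`. -/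
def iid (N : M) : 𝟙_ C ⟶ H.hom N N :=
  H.icoev (𝟙_ C) N ≫ (H.functor.obj (op N)).map (λₗ N).hom

lemma homEquiv_apply {X : C} {N N' : M} (f : X ⊙ₗ N ⟶ N') :
    H.homEquiv f = H.icoev X N ≫ (H.functor.obj (op N)).map f := by
  have h := H.adj.homEquiv_naturality_three (X₁ := N) (X₂ := X) f (𝟙 (X ⊙ₗ N))
  exact (congrArg H.homEquiv (Category.id_comp f).symm).trans h

lemma homEquiv_symm_apply {X : C} {N N' : M} (f : X ⟶ H.hom N N') :
    H.homEquiv.symm f = f ⊵ₗ N ≫ H.ieval N N' := by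
  have h := H.adj.homEquiv_symm_naturality_two (X₁ := N) f (𝟙 (H.hom N N'))
  rw [Category.comp_id] at h
  exact h

lemma hom_ext {X : C} {N N' : M} {f g : X ⟶ H.hom N N'}
    (h : f ⊵ₗ N ≫ H.ieval N N' = g ⊵ₗ N ≫ H.ieval N N') : f = g := by
  apply H.homEquiv.symm.injective
  rw [homEquiv_symm_apply, homEquiv_symm_apply, h]

lemma homEquiv_ieval {X : C} {N N' : M} (f : X ⊙ₗ N ⟶ N') :
    (H.homEquiv f) ⊵ₗ N ≫ H.ieval N N' = f := by
  rw [← homEquiv_symm_apply, Equiv.symm_apply_apply]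

lemma icomp_ieval (N₁ N₂ N₃ : M) : H.icomp N₁ N₂ N₃ ⊵ₗ N₁ ≫ H.ieval N₁ N₃ =
    (αₗ (H.hom N₂ N₃) (H.hom N₁ N₂) N₁).hom ≫
      H.hom N₂ N₃ ⊴ₗ H.ieval N₁ N₂ ≫ H.ieval N₂ N₃ :=
  H.homEquiv_ieval _

lemma iid_ieval (N : M) : H.iid N ⊵ₗ N ≫ H.ieval N N = (λₗ N).hom := by
  have : H.iid N = H.homEquiv (λₗ N).hom := (H.homEquiv_apply _).symm
  rw [this, homEquiv_ieval]

lemma whiskerRight_actionAssoc {X Y : C} (f : X ⟶ Y) (Z : C) (N : M) :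
    (f ▷ Z) ⊵ₗ N ≫ (αₗ Y Z N).hom = (αₗ X Z N).hom ≫ f ⊵ₗ (Z ⊙ₗ N) := by
  simp

lemma icomp_assoc (N₁ N₂ N₃ N₄ : M) :
    H.icomp N₂ N₃ N₄ ▷ H.hom N₁ N₂ ≫ H.icomp N₁ N₂ N₄ =
      (α_ (H.hom N₃ N₄) (H.hom N₂ N₃) (H.hom N₁ N₂)).hom ≫
        H.hom N₃ N₄ ◁ H.icomp N₁ N₂ N₃ ≫ H.icomp N₁ N₃ N₄ := by
  apply H.hom_ext
  simp only [MonoidalLeftAction.comp_actionHomLeft, Category.assoc, icomp_ieval,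
    reassoc_of% (whiskerRight_actionAssoc (C := C) (M := M)), MonoidalLeftAction.whiskerLeft_actionHomLeft,
    Iso.inv_hom_id_assoc, ← MonoidalLeftAction.action_exchange_assoc]
  rw [← MonoidalLeftAction.actionHomRight_comp_assoc _ (H.icomp N₁ N₂ N₃ ⊵ₗ N₁), icomp_ieval]
  simp

/-- The object `[N, N]` is an algebra in `C` by composition. -/
instance monObj (N : M) : MonObj (H.hom N N) where
  one := H.iid N
  mul := H.icomp N N N
  one_mul := by
    apply H.hom_ext
    simp only [MonoidalLeftAction.comp_actionHomLeft, Category.assoc, icomp_ieval,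
      reassoc_of% (whiskerRight_actionAssoc (C := C) (M := M)), ← MonoidalLeftAction.action_exchange_assoc, iid_ieval]
    simp
  mul_one := by
    apply H.hom_ext
    simp only [MonoidalLeftAction.comp_actionHomLeft, Category.assoc, icomp_ieval,
      MonoidalLeftAction.whiskerLeft_actionHomLeft, Iso.inv_hom_id_assoc]
    rw [← MonoidalLeftAction.actionHomRight_comp_assoc, iid_ieval]
    simp
  mul_assoc := H.icomp_assoc N N N N

end InternalHom

end InternalHom

/-! ### Relative Serre functors -/

section Serre

variable {C : Type u₁} [Category.{v₁} C] [MonoidalCategory C] [RigidCategory C]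
  {M : Type u₂} [Category.{v₂} M] [MonoidalLeftAction C M] (H : InternalHom C M)

/-- The left `C`-module structure `𝔞 : X ⊗ [N, N'] ⟶ [N, X ⊙ₗ N']` of `[N, -]`. -/
def leftStr (X : C) (N N' : M) : X ⊗ H.hom N N' ⟶ H.hom N (X ⊙ₗ N') :=
  H.homEquiv ((αₗ X (H.hom N N') N).hom ≫ X ⊴ₗ H.ieval N N')

/-- The right `C`-module structure `𝔟 : [N, N'] ⊗ X* ⟶ [X ⊙ₗ N, N']` of `[-, N']`, which
corresponds to `[N, N'] ⊙ₗ X* ⊙ₗ X ⊙ₗ N ⟶ [N, N'] ⊙ₗ N ⟶ N'`. -/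
def rightStr (X : C) (N N' : M) : H.hom N N' ⊗ dual X ⟶ H.hom (X ⊙ₗ N) N' :=
  H.homEquiv ((αₗ (H.hom N N') (dual X) (X ⊙ₗ N)).hom ≫
    H.hom N N' ⊴ₗ ((αₗ (dual X) X N).inv ≫ ev X ⊵ₗ N ≫ (λₗ N).hom) ≫ H.ieval N N')

/-- A relative Serre functor `(S, φ)` of `M`: an endofunctor `S` of `M` with an isomorphism
`φ : [N, N']* ≅ [N', S N]` natural in `N` and `N'` and compatible with the `C`-module structures in
the variable `N'`: the square with horizontal sides `φ` and `φ ⊗ X*` and vertical sides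
`[N, X ⊙ₗ N']* ⟶ (X ⊗ [N, N'])* ≅ [N, N']* ⊗ X*` and `[N', S N] ⊗ X* ⟶ [X ⊙ₗ N', S N]` commutes.

The compatibility in the variable `N` is not a condition on `φ`: given the above, there is exactly
one twisted module structure `X** ⊙ₗ S N ≅ S (X ⊙ₗ N)` on `S` which makes `φ` an isomorphism of
`C`-bimodule functors. -/
structure RelativeSerreFunctor where
  functor : M ⥤ M
  φ (N N' : M) : dual (H.hom N N') ≅ H.hom N' (functor.obj N)
  naturality_left {N₁ N₂ : M} (f : N₁ ⟶ N₂) (N' : M) :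
    dualMap (H.map f (𝟙 N')) ≫ (φ N₂ N').hom = (φ N₁ N').hom ≫ H.map (𝟙 N') (functor.map f)
  naturality_right (N : M) {N₁ N₂ : M} (g : N₁ ⟶ N₂) :
    dualMap (H.map (𝟙 N) g) ≫ (φ N N₁).hom = (φ N N₂).hom ≫ H.map g (𝟙 (functor.obj N))
  module_right (X : C) (N N' : M) :
    dualMap (leftStr H X N N') ≫ (dualTensorIso X (H.hom N N')).hom ≫
      (φ N N').hom ▷ dual X ≫ rightStr H X N' (functor.obj N) = (φ N (X ⊙ₗ N')).hom

variable {H}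

/-- The trace `tr_N : [N, S N] ⟶ [N, N]* ⟶ 𝟙* ≅ 𝟙`, the composite of `φ_{N,N}⁻¹` and the dual of
the unit `𝟙 ⟶ [N, N]`. -/
noncomputable def RelativeSerreFunctor.trace (S : RelativeSerreFunctor H) (N : M) :
    H.hom N (S.functor.obj N) ⟶ 𝟙_ C :=
  (S.φ N N).inv ≫ dualMap (H.iid N) ≫ (dualUnitIso C).hom

end Serre

end RelSerre

namespace RelSerre

/-! ### Duals as evaluation pairings -/

section Dual

variable {C : Type u₁} [Category.{v₁} C] [MonoidalCategory C]

/-! The heart is `φ_hom_icomp_trace`: under `φ`, composing and then taking the trace is the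
evaluation pairing of `[N, N']` with its dual. Indeed `N'` receives `ev : [N, N'] ⊙ₗ N ⟶ N'`;
naturality of `φ` along this map and module compatibility for `X = [N, N']` express `φ_{N,N'}`
through `φ_{N,N}` (`φ_hom_icomp`), and the trace then undoes `φ_{N,N}` and inserts the unit of `[N,
N]`. A morphism into a dual is determined by its pairing, so `ψ = φ_{N,N}⁻¹ ∘ [N, p]`
(`frobeniusMap_trace`), which is invertible. The dual of `ψ⁻¹` contains `[N, p⁻¹]*`, and naturality
of `φ` in its second variable turns this into `[p⁻¹, S N]` conjugated by `φ`; the Nakayama formula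
follows by cancellation. -/

lemma rightDualIso_hom_evaluation {X Y₁ Y₂ : C} (p₁ : ExactPairing X Y₁)
    (p₂ : ExactPairing X Y₂) :
    (rightDualIso p₁ p₂).hom ▷ X ≫ p₂.evaluation X Y₂ = p₁.evaluation X Y₁ := by
  let i₁ : HasRightDual X := @HasRightDual.mk _ _ _ X Y₁ p₁
  let i₂ : HasRightDual X := @HasRightDual.mk _ _ _ X Y₂ p₂
  have h := @rightAdjointMate_comp_evaluation _ _ _ X X i₂ i₁ (𝟙 X)
  rw [whiskerLeft_id, Category.id_comp] at h
  exact h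

/-- By interchange, the point `u` may be inserted before the contraction `e` instead of after it.
With `f` the splitting of `(X ⊗ B)*`, the right side becomes the nested evaluation of `X ⊗ B`. -/
lemma whiskerRight_comp_point {D E X Y B : C} (f : D ⟶ E ⊗ Y) (e : Y ⊗ X ⟶ 𝟙_ C) (u : 𝟙_ C ⟶ B)
    (b : E ⊗ B ⟶ 𝟙_ C) :
    f ▷ X ≫ (α_ E Y X).hom ≫ E ◁ e ≫ E ◁ u ≫ b =
      (ρ_ (D ⊗ X)).inv ≫ (α_ D X (𝟙_ C)).hom ≫ D ◁ X ◁ u ≫ f ▷ (X ⊗ B) ≫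
        (α_ E Y (X ⊗ B)).hom ≫ E ◁ ((α_ Y X B).inv ≫ e ▷ B ≫ (λ_ B).hom) ≫ b := by
  rw [whisker_exchange_assoc]
  calc
    _ = 𝟙 _ ⊗≫ f ▷ X ⊗≫ E ◁ (e ▷ 𝟙_ C ≫ 𝟙_ C ◁ u) ⊗≫ b := by monoidal
    _ = 𝟙 _ ⊗≫ f ▷ X ⊗≫ E ◁ ((Y ⊗ X) ◁ u ≫ e ▷ B) ⊗≫ b := by rw [whisker_exchange]
    _ = _ := by monoidal

variable [RigidCategory C]

lemma dualMap_ev {X Y : C} (f : X ⟶ Y) : dualMap f ▷ X ≫ ev X = dual Y ◁ f ≫ ev Y :=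
  rightAdjointMate_comp_evaluation f

lemma dualMap_comp {X Y Z : C} (f : X ⟶ Y) (g : Y ⟶ Z) :
    dualMap (f ≫ g) = dualMap g ≫ dualMap f :=
  comp_rightAdjointMate

lemma dualTensorIso_hom_evaluation (X Y : C) :
    (dualTensorIso X Y).hom ▷ (X ⊗ Y) ≫ (α_ (dual Y) (dual X) (X ⊗ Y)).hom ≫
      dual Y ◁ ((α_ (dual X) X Y).inv ≫ ev X ▷ Y ≫ (λ_ Y).hom) ≫ ev Y = ev (X ⊗ Y) := by
  have h := rightDualIso_hom_evaluation (X := X ⊗ Y)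
    (RightRigidCategory.rightDual (X ⊗ Y)).exact
    (ExactPairing.tensor (Y₁ := dual X) (Y₂ := dual Y))
  change (dualTensorIso X Y).hom ▷ (X ⊗ Y) ≫ ε_ (X ⊗ Y) (dual Y ⊗ dual X) = ev (X ⊗ Y) at h
  rw [← h, ExactPairing.tensor_evaluation]
  monoidal

/-- Under `𝟙* ≅ 𝟙`, the dual of a point `u` of `X` is evaluation at `u`. -/
lemma dualMap_dualUnitIso_hom {X : C} (u : 𝟙_ C ⟶ X) :
    dualMap u ≫ (dualUnitIso C).hom = (ρ_ (dual X)).inv ≫ dual X ◁ u ≫ ev X := by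
  have h := rightDualIso_hom_evaluation (X := 𝟙_ C)
    (RightRigidCategory.rightDual (𝟙_ C)).exact exactPairingUnit
  change (dualUnitIso C).hom ▷ 𝟙_ C ≫ (ρ_ (𝟙_ C)).hom = ev (𝟙_ C) at h
  rw [← dualMap_ev, ← h]
  simp

/-- `ψ` is the transpose of `λ ∘ μ` under the duality adjunction, so this is a snake identity. -/
lemma frobeniusMap_ev (A : C) [MonObj A] (lam : A ⟶ 𝟙_ C) :
    frobeniusMap A lam ▷ A ≫ ev A = MonObj.mul ≫ lam := by
  have h := (tensorRightHomEquiv A A (dual A) (𝟙_ C)).left_inv (MonObj.mul ≫ lam)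
  rw [← h]
  simp [tensorRightHomEquiv, frobeniusMap, unitors_inv_equal]

lemma eq_of_whiskerRight_ev {X Y : C} {f g : X ⟶ dual Y}
    (h : f ▷ Y ≫ ev Y = g ▷ Y ≫ ev Y) : f = g := by
  apply (cancel_mono (λ_ (dual Y)).inv).1
  apply (tensorRightHomEquiv X Y (dual Y) (𝟙_ C)).symm.injective
  simp [tensorRightHomEquiv, reassoc_of% h]

end Dual

/-! ### Composition and module structures of the internal Hom -/

namespace InternalHom

variable {C : Type u₁} [Category.{v₁} C] [MonoidalCategory C]
  {M : Type u₂} [Category.{v₂} M] [MonoidalLeftAction C M] (H : InternalHom C M)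

lemma map_ieval {N₁ N₂ N' N'' : M} (f : N₁ ⟶ N₂) (g : N' ⟶ N'') :
    H.map f g ⊵ₗ N₁ ≫ H.ieval N₁ N'' = H.hom N₂ N' ⊴ₗ f ≫ H.ieval N₂ N' ≫ g := by
  rw [← homEquiv_symm_apply]
  have h₁ := H.adj.homEquiv_symm_naturality_three g ((H.functor.map f.op).app N')
  have h₂ := H.adj.homEquiv_symm_naturality_one f (𝟙 (H.hom N₂ N'))
  rw [Category.id_comp] at h₂
  rw [h₂] at h₁
  exact h₁.trans (Category.assoc _ _ _)

lemma map_comp_map {N₁ N₂ N₃ P₁ P₂ P₃ : M} (f : N₁ ⟶ N₂) (f' : N₂ ⟶ N₃) (g : P₁ ⟶ P₂)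
    (g' : P₂ ⟶ P₃) : H.map f' g ≫ H.map f g' = H.map (f ≫ f') (g ≫ g') := by
  simp [map]

lemma map_id (N P : M) : H.map (𝟙 N) (𝟙 P) = 𝟙 (H.hom N P) := by
  simp [map]

lemma icoev_ieval (X : C) (N : M) : H.icoev X N ⊵ₗ N ≫ H.ieval N (X ⊙ₗ N) = 𝟙 (X ⊙ₗ N) :=
  H.homEquiv_ieval _

lemma icomp_map (N₁ N₂ : M) {N₃ N₄ : M} (g : N₃ ⟶ N₄) :
    H.icomp N₁ N₂ N₃ ≫ H.map (𝟙 N₁) g = H.map (𝟙 N₂) g ▷ H.hom N₁ N₂ ≫ H.icomp N₁ N₂ N₄ := by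
  apply H.hom_ext
  simp only [MonoidalLeftAction.comp_actionHomLeft, Category.assoc, map_ieval, icomp_ieval,
    reassoc_of% (whiskerRight_actionAssoc (C := C) (M := M)),
    ← MonoidalLeftAction.action_exchange_assoc]
  simp [reassoc_of% H.icomp_ieval]

/-- The composition with the unit of the adjunction. -/
def icompIcoev (X : C) (N P : M) : H.hom (X ⊙ₗ N) P ⊗ X ⟶ H.hom N P :=
  H.hom (X ⊙ₗ N) P ◁ H.icoev X N ≫ H.icomp N (X ⊙ₗ N) P

lemma icompIcoev_ieval (X : C) (N P : M) :
    H.icompIcoev X N P ⊵ₗ N ≫ H.ieval N P =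
      (αₗ (H.hom (X ⊙ₗ N) P) X N).hom ≫ H.ieval (X ⊙ₗ N) P := by
  simp only [icompIcoev, MonoidalLeftAction.comp_actionHomLeft, Category.assoc, icomp_ieval,
      MonoidalLeftAction.whiskerLeft_actionHomLeft, Iso.inv_hom_id_assoc]
  rw [← MonoidalLeftAction.actionHomRight_comp_assoc, icoev_ieval]
  simp

/-- Composition factors through precomposition with evaluation, a map to which naturality of `φ`
applies. -/
lemma map_ieval_icompIcoev (N N' P : M) :
    H.map (H.ieval N N') (𝟙 P) ▷ H.hom N N' ≫ H.icompIcoev (H.hom N N') N P =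
      H.icomp N N' P := by
  apply H.hom_ext
  simp only [MonoidalLeftAction.comp_actionHomLeft, Category.assoc, icompIcoev_ieval, icomp_ieval,
    reassoc_of% (whiskerRight_actionAssoc (C := C) (M := M)), map_ieval, Category.comp_id]

lemma leftStr_map_ieval [RigidCategory C] (N N' : M) :
    leftStr H (H.hom N N') N N ≫ H.map (𝟙 N) (H.ieval N N') = H.icomp N N N' := by
  apply H.hom_ext
  simp only [MonoidalLeftAction.comp_actionHomLeft, Category.assoc, map_ieval, icomp_ieval]
  have h : leftStr H (H.hom N N') N N ⊵ₗ N ≫ H.ieval N _ = _ := H.homEquiv_ieval _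
  simp [reassoc_of% h]

/-- `rightStr` acts by contracting `X*` against the `X` of `X ⊙ₗ N`; `icompIcoev` supplies that `X`,
leaving only `ev X`. -/
lemma rightStr_icompIcoev [RigidCategory C] (X : C) (N P : M) :
    rightStr H X N P ▷ X ≫ H.icompIcoev X N P =
      (α_ (H.hom N P) (dual X) X).hom ≫ H.hom N P ◁ ev X ≫ (ρ_ (H.hom N P)).hom := by
  apply H.hom_ext
  have h : rightStr H X N P ⊵ₗ (X ⊙ₗ N) ≫ H.ieval _ P = _ := H.homEquiv_ieval _
  simp only [MonoidalLeftAction.comp_actionHomLeft, Category.assoc, icompIcoev_ieval,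
    reassoc_of% (whiskerRight_actionAssoc (C := C) (M := M)), h]
  rw [← MonoidalLeftAction.associator_actionHom_assoc]
  simp

lemma iid_icomp (N N' : M) :
    H.hom N N' ◁ H.iid N ≫ H.icomp N N N' = (ρ_ (H.hom N N')).hom := by
  apply H.hom_ext
  simp only [MonoidalLeftAction.comp_actionHomLeft, Category.assoc, icomp_ieval,
    MonoidalLeftAction.whiskerLeft_actionHomLeft, Iso.inv_hom_id_assoc]
  rw [← MonoidalLeftAction.actionHomRight_comp_assoc, iid_ieval]
  simp

end InternalHom

/-! ### The trace pairing and the Frobenius form -/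

namespace RelativeSerreFunctor

variable {C : Type u₁} [Category.{v₁} C] [MonoidalCategory C] [RigidCategory C]
  {M : Type u₂} [Category.{v₂} M] [MonoidalLeftAction C M] {H : InternalHom C M}
  (S : RelativeSerreFunctor H)

lemma φ_hom_icomp (N N' : M) :
    (S.φ N N').hom ▷ H.hom N N' ≫ H.icomp N N' (S.functor.obj N) =
      (dualMap (H.icomp N N N') ≫ (dualTensorIso (H.hom N N') (H.hom N N)).hom) ▷ H.hom N N' ≫
        (α_ _ _ _).hom ≫ dual (H.hom N N) ◁ ev (H.hom N N') ≫ (ρ_ _).hom ≫ (S.φ N N).hom := by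
  -- Naturality along `ieval N N'` replaces `φ_{N,N'}` by `φ_{N,X ⊙ₗ N}` with `X = [N, N']`, which
  -- `module_right` reduces to `φ_{N,N}`.
  rw [← H.map_ieval_icompIcoev, ← comp_whiskerRight_assoc, ← S.naturality_right,
    ← S.module_right, ← H.leftStr_map_ieval, dualMap_comp]
  simp only [comp_whiskerRight, Category.assoc, H.rightStr_icompIcoev]
  rw [associator_naturality_left_assoc, ← whisker_exchange_assoc]
  simp

/-- The trace pairing `[N', S N] ⊗ [N, N'] ⟶ [N, S N] ⟶ 𝟙` corresponds under `φ` to the evaluation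
of `[N, N']`. -/
lemma φ_hom_icomp_trace (N N' : M) :
    (S.φ N N').hom ▷ H.hom N N' ≫ H.icomp N N' (S.functor.obj N) ≫ S.trace N =
      ev (H.hom N N') := by
  -- Once `φ_{N,N}` cancels, the dual of composition is evaluated at the unit of `[N, N]`; the unit
  -- law `iid_icomp` leaves `ev`.
  rw [reassoc_of% S.φ_hom_icomp, trace, Iso.hom_inv_id_assoc, dualMap_dualUnitIso_hom,
    Iso.hom_inv_id_assoc, whiskerRight_comp_point, comp_whiskerRight_assoc,
    dualTensorIso_hom_evaluation, dualMap_ev, ← whiskerLeft_comp_assoc, H.iid_icomp]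
  simp

lemma frobeniusMap_trace (N : M) (p : N ⟶ S.functor.obj N) :
    frobeniusMap (H.hom N N) (H.map (𝟙 N) p ≫ S.trace N) =
      H.map (𝟙 N) p ≫ (S.φ N N).inv := by
  apply eq_of_whiskerRight_ev
  rw [frobeniusMap_ev, ← S.φ_hom_icomp_trace]
  -- Multiplication on `[N, N]` is `icomp` by definition; `icomp_map` moves `p` to the left factor.
  change H.icomp N N N ≫ _ = _
  rw [reassoc_of% H.icomp_map]
  simp

lemma dualMap_map_eq {N N₁ N₂ : M} (g : N₁ ⟶ N₂) :
    dualMap (H.map (𝟙 N) g) =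
      (S.φ N N₂).hom ≫ H.map g (𝟙 (S.functor.obj N)) ≫ (S.φ N N₁).inv := by
  rw [← reassoc_of% S.naturality_right, Iso.hom_inv_id, Category.comp_id]

end RelativeSerreFunctor

end RelSerre

theorem mainTheorem7 {k : Type w} [Field k] [IsAlgClosed k]
    {C : Type u₁} [Category.{v₁} C] [Abelian C] [Linear k C] [MonoidalCategory C] [RigidCategory C]
    [RelSerre.IsFiniteTensorCategory k C] (piv : RelSerre.PivotalStructure C)
    {M : Type u₂} [Category.{v₂} M] [Abelian M] [Linear k M] [MonoidalLeftAction C M]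
    [RelSerre.IsExactModuleCategory k C M]
    (H : RelSerre.InternalHom C M) (S : RelSerre.RelativeSerreFunctor H)
    (N : M) (p : N ≅ S.functor.obj N) :
    ∃ _ : RelSerre.IsFrobeniusAlgebra (H.hom N N) (H.map (𝟙 N) p.hom ≫ S.trace N),
      RelSerre.nakayama piv (H.hom N N) (H.map (𝟙 N) p.hom ≫ S.trace N) =
        H.map p.inv p.hom ≫ (S.φ N (S.functor.obj N)).inv ≫
          RelSerre.dualMap (S.φ N N).hom ≫ (piv.iso (H.hom N N)).inv := by
  have e := S.frobeniusMap_trace N p.hom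
  have hp : H.map (𝟙 N) p.hom ≫ H.map (𝟙 N) p.inv = 𝟙 _ := by
    simp [H.map_comp_map, H.map_id]
  have hp' : H.map (𝟙 N) p.inv ≫ H.map (𝟙 N) p.hom = 𝟙 _ := by
    simp [H.map_comp_map, H.map_id]
  have h₁ : (H.map (𝟙 N) p.hom ≫ (S.φ N N).inv) ≫ (S.φ N N).hom ≫ H.map (𝟙 N) p.inv = 𝟙 _ := by
    simp [hp]
  have h₂ : ((S.φ N N).hom ≫ H.map (𝟙 N) p.inv) ≫ H.map (𝟙 N) p.hom ≫ (S.φ N N).inv = 𝟙 _ := by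
    simp [reassoc_of% hp']
  rw [← e] at h₁ h₂
  have F : RelSerre.IsFrobeniusAlgebra (H.hom N N) (H.map (𝟙 N) p.hom ≫ S.trace N) :=
    ⟨⟨_, h₁, h₂⟩⟩
  refine ⟨F, ?_⟩
  -- `dualMap_map_eq` at `p⁻¹` produces a `φ_{N,N}` that cancels the `φ_{N,N}⁻¹` in `ψ`, so `[N, p]`
  -- and `[p⁻¹, S N]` merge into `[p⁻¹, p]`.
  rw [RelSerre.nakayama, IsIso.inv_eq_of_hom_inv_id h₁, e, RelSerre.dualMap_comp,
    S.dualMap_map_eq]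
  simp only [Category.assoc, Iso.inv_hom_id_assoc, reassoc_of% H.map_comp_map, Category.comp_id]
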